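/- Let $V$ be a finite set of points in the Euclidean plane (the regular points) and let $S$ be a Steiner minimal tree for $V$, i.e. a shortest network of straight edges interconnecting $V$; its vertices outside $V$ are the Steiner points, and they are required to have degree at least $3$ (no edge is subdivided by an auxiliary vertex). Let $A\in V$, let $X,Y,Z$ be Steiner points of $S$ and let $R$ be a vertex of $S$ (regular or Steiner), such that $AX$, $XY$, $YZ$, $ZR$ are edges of $S$ and the polygonal path $A\to X\to Y\to Z\to R$ turns right (clockwise) at each of $X$, $Y$, $Z$. Normalize $|AX|=1$ and put $s=|XY|$, $c=|YZ|$, $e=|ZR|$. If $e<s+1$, then there exists a regular point $E\in V$, lying beyond $R$ as seen from $A$ (that is, the path in $S$ from $A$ to $E$ begins with $A,X,Y,Z,R$, where $E=R$ is allowed), such that $$|AE|\le\max\{|AY|,\ |AZ|,\ |AR|,\ e+c-1\}.$$ -/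

import Mathlib

/-! Steiner minimal trees in the Euclidean plane, which is modelled by `ℂ` (whose distance is the
Euclidean one). A network is a finite set of straight edges, each given by its two endpoints. -/

/-- The Euclidean length of an edge. -/
noncomputable def edgeLength : Sym2 ℂ → ℝ :=
  Sym2.lift ⟨fun x y => dist x y, fun x y => dist_comm x y⟩

/-- The total length of a network. -/
noncomputable def netLength (S : Finset (Sym2 ℂ)) : ℝ := ∑ a ∈ S, edgeLength a

/-- The graph of a network: two distinct points are adjacent if they are joined by an edge. -/
def netGraph (S : Finset (Sym2 ℂ)) : SimpleGraph ℂ :=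
  SimpleGraph.fromEdgeSet (S : Set (Sym2 ℂ))

/-- The network `S` interconnects all points of `V` (possibly through auxiliary vertices). -/
def Interconnects (S : Finset (Sym2 ℂ)) (V : Finset ℂ) : Prop :=
  ∀ u ∈ V, ∀ v ∈ V, (netGraph S).Reachable u v

/-- The Steiner points of a network `S` on the set `V` of regular points: the vertices of `S` that
are not in `V`. -/
def IsSteinerPoint (V : Finset ℂ) (S : Finset (Sym2 ℂ)) (p : ℂ) : Prop :=
  p ∉ V ∧ ∃ q, (netGraph S).Adj p q

/-- `S` is a Steiner minimal tree for `V`: a shortest network interconnecting `V`. As usual, an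
edge is not subdivided by auxiliary vertices of degree two, that is, every auxiliary vertex is a
genuine branching point. (That such a network is a tree, that its Steiner points have degree exactly
three and that its edges meet there at 120 degrees are consequences, not part of the definition.) -/
structure IsSteinerMinimalTree (V : Finset ℂ) (S : Finset (Sym2 ℂ)) : Prop where
  loopless : ∀ a ∈ S, ¬ a.IsDiag
  interconnects : Interconnects S V
  minimal : ∀ S' : Finset (Sym2 ℂ), Interconnects S' V → netLength S ≤ netLength S'
  three_le_degree : ∀ p, IsSteinerPoint V S p → 3 ≤ ((netGraph S).neighborSet p).ncard

/-- Going from `P` to `Q` and on to `R`, one turns right (clockwise) at `Q`: the cross product of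
`Q - P` and `R - Q` is negative. -/
def RightTurn (P Q R : ℂ) : Prop :=
  (Q - P).re * (R - Q).im - (Q - P).im * (R - Q).re < 0

/-! Edges at a Steiner point meet at 120 degrees, so three right turns make `ZR` antiparallel to
`AX`, and `e ≤ s + 1` says exactly that the angle `ARZ` is at least 60 degrees
(`inner_le_of_three_rightTurns`). This angle condition propagates (`exists_regular_extension`). If
the path from `A` ends at a Steiner point `P`, some other edge `PQ` makes an angle of at most 60
degrees with `PA`. Exchanging `PQ` for `AQ` shows `|PQ| ≤ |AQ|`, hence `|PQ| ≤ |AQ| ≤ |AP|`. Since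
`AP` is a longest side of the triangle, the angle at `Q` is again at least 60 degrees. The distance
to `A` never grows and the path cannot lengthen forever, so it ends at a regular `E` with `|AE| ≤
|AR|`. -/

open scoped RealInnerProductSpace

/-! ### Plane geometry -/

/-- Two segments from the origin that enclose an angle of less than 120 degrees can be shortened by
branching at a point `m`. -/
theorem exists_shorter_branching {a b : ℂ} (ha : a ≠ 0) (hb : b ≠ 0)
    (h : -(‖a‖ * ‖b‖ / 2) < ⟪a, b⟫) : ∃ m : ℂ, ‖m‖ + ‖a - m‖ + ‖b - m‖ < ‖a‖ + ‖b‖ := by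
  have key : ∀ u v : ℂ, ‖u‖ = 1 → ‖v‖ = 1 → -(1 / 2) < ⟪u, v⟫ →
      ∃ m : ℂ, ‖m‖ + ‖u - m‖ + ‖v - m‖ < 2 := by
    intro u v hu hv huv
    have hw : ‖u + v‖ ^ 2 = 2 + 2 * ⟪u, v⟫ := by rw [norm_add_sq_real, hu, hv]; ring
    set r := ‖u + v‖ with hr
    have hr1 : 1 < r := by nlinarith [norm_nonneg (u + v)]
    have hr2 : r ≤ 2 := by have := norm_add_le u v; rw [hu, hv] at this; linarith
    -- With `x = k * r` the length of the stem, the saving is at least `x * (r - 1 - x)`; this `k`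
    -- maximizes it.
    set k : ℝ := (1 - 1 / r) / 2 with hk
    have hkr : 2 * (k * r) = r - 1 := by rw [hk]; field_simp
    have hk0 : 0 < k := by by_contra hk0; nlinarith
    have bound : ∀ x y : ℂ, ‖x‖ = 1 → ‖y‖ = 1 → ⟪x, y⟫ = ⟪u, v⟫ →
        ‖x - k • (x + y)‖ ≤ 1 - (k * r ^ 2 - (k * r) ^ 2) / 2 := by
      intro x y hx hy hxy
      have h1 : ‖x - k • (x + y)‖ ^ 2 = 1 - (k * r ^ 2 - (k * r) ^ 2) := by
        rw [norm_sub_sq_real, norm_smul, mul_pow, norm_add_sq_real, real_inner_smul_right,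
          inner_add_right, real_inner_self_eq_norm_sq, hx, hy, hxy, Real.norm_eq_abs, sq_abs,
          mul_pow, hw]
        ring
      nlinarith [norm_nonneg (x - k • (x + y)), sq_nonneg (‖x - k • (x + y)‖ - 1)]
    refine ⟨k • (u + v), ?_⟩
    have h1 := bound u v hu hv rfl
    have h2 := bound v u hv hu (real_inner_comm _ _)
    rw [add_comm v u] at h2
    have h3 : ‖k • (u + v)‖ = k * r := by rw [norm_smul, Real.norm_of_nonneg hk0.le]
    have hkr0 : 0 < k * r := by positivity
    nlinarith
  have na : 0 < ‖a‖ := norm_pos_iff.2 ha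
  have nb : 0 < ‖b‖ := norm_pos_iff.2 hb
  obtain ⟨m, hm⟩ := key (‖a‖⁻¹ • a) (‖b‖⁻¹ • b) (norm_smul_inv_norm ha) (norm_smul_inv_norm hb) (by
    rw [real_inner_smul_left, real_inner_smul_right]
    have : ‖a‖⁻¹ * (‖b‖⁻¹ * ⟪a, b⟫) = ⟪a, b⟫ / (‖a‖ * ‖b‖) := by field_simp
    rw [this, lt_div_iff₀ (by positivity)]
    linarith)
  -- Branch as in the unit case, scaled by the shorter length `t`; the rest of the longer segment is
  -- kept.
  have leg : ∀ (x : ℂ) (t : ℝ), x ≠ 0 → 0 < t → t ≤ ‖x‖ →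
      ‖x - t • m‖ ≤ ‖x‖ - t + t * ‖‖x‖⁻¹ • x - m‖ := by
    intro x t hx ht htx
    have hx' : ‖x‖ ≠ 0 := norm_ne_zero_iff.2 hx
    have e1 : x - t • m = (‖x‖ - t) • (‖x‖⁻¹ • x) + t • (‖x‖⁻¹ • x - m) := by
      rw [sub_smul, smul_sub, smul_smul ‖x‖, mul_inv_cancel₀ hx', one_smul]
      abel
    have hu : ‖‖x‖⁻¹ • x‖ = 1 := norm_smul_inv_norm hx
    calc ‖x - t • m‖ ≤ ‖(‖x‖ - t) • (‖x‖⁻¹ • x)‖ + ‖t • (‖x‖⁻¹ • x - m)‖ := by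
          rw [e1]; exact norm_add_le _ _
      _ = ‖x‖ - t + t * ‖‖x‖⁻¹ • x - m‖ := by
          rw [norm_smul (‖x‖ - t), norm_smul t, hu, Real.norm_of_nonneg (sub_nonneg.2 htx),
            Real.norm_of_nonneg ht.le, mul_one]
  have ht : 0 < min ‖a‖ ‖b‖ := lt_min na nb
  set t := min ‖a‖ ‖b‖
  refine ⟨t • m, ?_⟩
  have h1 := leg a t ha ht (min_le_left _ _)
  have h2 := leg b t hb ht (min_le_right _ _)
  have h3 : ‖t • m‖ = t * ‖m‖ := by rw [norm_smul, Real.norm_of_nonneg ht.le]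
  nlinarith [mul_lt_mul_of_pos_left hm ht]

/-- Three unit vectors that pairwise enclose at least 120 degrees sum to zero and pairwise enclose
exactly 120 degrees. -/
theorem unit_triple_rigid {u v w : ℂ} (hu : ‖u‖ = 1) (hv : ‖v‖ = 1) (hw : ‖w‖ = 1)
    (huv : ⟪u, v⟫ ≤ -(1 / 2)) (huw : ⟪u, w⟫ ≤ -(1 / 2)) (hvw : ⟪v, w⟫ ≤ -(1 / 2)) :
    u + v + w = 0 ∧ ⟪u, v⟫ = -(1 / 2) := by
  have h : ‖u + v + w‖ ^ 2 = 3 + 2 * (⟪u, v⟫ + ⟪u, w⟫ + ⟪v, w⟫) := by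
    rw [norm_add_sq_real, norm_add_sq_real, inner_add_left, hu, hv, hw]; ring
  -- The inner products sum to at most `-3/2`, so a nonnegative square leaves no slack.
  have h0 := sq_nonneg ‖u + v + w‖
  exact ⟨norm_eq_zero.1 (pow_eq_zero_iff two_ne_zero |>.1 (by linarith)), by linarith⟩

/-- If three unit vectors pairwise enclose 120 degrees, then a vector that makes an angle of at
least 60 degrees with one of them makes an angle of at most 60 degrees with another one. -/
theorem unit_triple_cover {u v w : ℂ} (hu : ‖u‖ = 1) (hv : ‖v‖ = 1) (hw : ‖w‖ = 1)
    (huv : ⟪u, v⟫ ≤ -(1 / 2)) (huw : ⟪u, w⟫ ≤ -(1 / 2)) (hvw : ⟪v, w⟫ ≤ -(1 / 2))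
    {x : ℂ} (hx : ⟪x, u⟫ ≤ ‖x‖ / 2) : ‖x‖ / 2 ≤ ⟪x, v⟫ ∨ ‖x‖ / 2 ≤ ⟪x, w⟫ := by
  obtain ⟨h0, h1⟩ := unit_triple_rigid hu hv hw huv huw hvw
  have hsum : ⟪x, u⟫ + ⟪x, v⟫ + ⟪x, w⟫ = 0 := by
    rw [← inner_add_right, ← inner_add_right, h0, inner_zero_right]
  -- The Gram determinant of three plane vectors vanishes.
  have gram : ⟪x, u⟫ ^ 2 + ⟪x, v⟫ ^ 2 + ⟪x, u⟫ * ⟪x, v⟫ = 3 / 4 * ‖x‖ ^ 2 := by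
    have e : ‖x‖ ^ 2 * (‖u‖ ^ 2 * ‖v‖ ^ 2 - ⟪u, v⟫ ^ 2) =
        ‖v‖ ^ 2 * ⟪x, u⟫ ^ 2 + ‖u‖ ^ 2 * ⟪x, v⟫ ^ 2 - 2 * ⟪u, v⟫ * (⟪x, u⟫ * ⟪x, v⟫) := by
      simp only [Complex.sq_norm, Complex.normSq_apply, Complex.inner, Complex.mul_re,
        Complex.conj_re, Complex.conj_im]
      ring
    rw [hu, hv, h1] at e
    linarith
  by_contra! hcon
  obtain ⟨h2, h3⟩ := hcon
  have hlow : -‖x‖ ≤ ⟪x, u⟫ := by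
    have := (abs_le.1 (abs_real_inner_le_norm x u)).1
    rwa [hu, mul_one] at this
  have hw' : ⟪x, w⟫ = -⟪x, u⟫ - ⟪x, v⟫ := by linarith
  rw [hw'] at h3
  -- By `gram`, the first product equals `(a - ‖x‖ / 2) * (a + ‖x‖)` with `a = ⟪x, u⟫`, which cannot
  -- be positive for `-‖x‖ ≤ a ≤ ‖x‖ / 2`.
  nlinarith [mul_pos (sub_pos.2 h2) (sub_pos.2 h3), mul_nonneg (sub_nonneg.2 hx)
    (neg_le_iff_add_nonneg.1 hlow)]

/-- A right turn by 60 degrees is multiplication by `exp (-π i / 3)`. -/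
theorem eq_mul_of_rightTurn {P Q R : ℂ} (hQP : Q ≠ P)
    (hang : ⟪P - Q, R - Q⟫ = -(dist P Q * dist Q R / 2)) (hturn : RightTurn P Q R) :
    R - Q = ((dist Q R / dist P Q : ℝ) : ℂ) * ⟨1 / 2, -(√3 / 2)⟩ * (Q - P) := by
  have hd : 0 < dist P Q := dist_pos.2 hQP.symm
  have hn1 : dist P Q ^ 2 = (Q - P).re ^ 2 + (Q - P).im ^ 2 := by
    rw [dist_comm, dist_eq_norm, Complex.sq_norm, Complex.normSq_apply]; ring
  have hn2 : dist Q R ^ 2 = (R - Q).re ^ 2 + (R - Q).im ^ 2 := by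
    rw [dist_comm, dist_eq_norm, Complex.sq_norm, Complex.normSq_apply]; ring
  have hdot : (Q - P).re * (R - Q).re + (Q - P).im * (R - Q).im = dist P Q * dist Q R / 2 := by
    rw [← neg_sub Q P, inner_neg_left] at hang
    simp only [Complex.inner, Complex.mul_re, Complex.conj_re, Complex.conj_im] at hang
    linarith
  unfold RightTurn at hturn
  have hnn : 0 ≤ dist Q R := dist_nonneg
  generalize dist P Q = m at *
  generalize dist Q R = n at *
  generalize Q - P = a at *
  generalize R - Q = b at *
  have h3 : √3 ^ 2 = 3 := Real.sq_sqrt (by norm_num)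
  -- Lagrange's identity gives the cross product up to sign; the right turn fixes the sign.
  have hcross : a.re * b.im - a.im * b.re = -(m * n * √3 / 2) := by
    have hsq : (a.re * b.im - a.im * b.re) ^ 2 = (m * n * √3 / 2) ^ 2 := by
      have : (a.re * b.im - a.im * b.re) ^ 2 + (a.re * b.re + a.im * b.im) ^ 2 = m ^ 2 * n ^ 2 := by
        rw [hn1, hn2]; ring
      rw [hdot] at this
      nlinarith
    rcases sq_eq_sq_iff_eq_or_eq_neg.1 hsq with h | h
    · have : 0 ≤ m * n * √3 / 2 := by positivity
      linarith
    · exact h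
  apply Complex.ext
  · simp only [Complex.mul_re, Complex.mul_im, Complex.ofReal_re, Complex.ofReal_im]
    field_simp
    apply mul_left_cancel₀ hd.ne'
    linear_combination 2 * b.re * hn1 + 2 * a.re * hdot - 2 * a.im * hcross
  · simp only [Complex.mul_re, Complex.mul_im, Complex.ofReal_re, Complex.ofReal_im]
    field_simp
    apply mul_left_cancel₀ hd.ne'
    linear_combination 2 * b.im * hn1 + 2 * a.im * hdot + 2 * a.re * hcross

/-- For a path that makes three right turns by 60 degrees, with first edge of length one, the
triangle `A R Z` has an angle of at least 60 degrees at `R` if `|ZR| ≤ |XY| + 1`. -/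
theorem inner_le_of_three_rightTurns {A X Y Z R : ℂ}
    (hX : ⟪A - X, Y - X⟫ = -(dist A X * dist X Y / 2))
    (hY : ⟪X - Y, Z - Y⟫ = -(dist X Y * dist Y Z / 2))
    (hZ : ⟪Y - Z, R - Z⟫ = -(dist Y Z * dist Z R / 2))
    (turnX : RightTurn A X Y) (turnY : RightTurn X Y Z) (turnZ : RightTurn Y Z R)
    (hXY : X ≠ Y) (hYZ : Y ≠ Z) (h1 : dist A X = 1)
    (hes : dist Z R ≤ dist X Y + 1) : ⟪A - R, Z - R⟫ ≤ dist A R * dist R Z / 2 := by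
  have hAX : A ≠ X := by rintro rfl; simp at h1
  have eX := eq_mul_of_rightTurn hAX.symm hX turnX
  have eY := eq_mul_of_rightTurn hXY.symm hY turnY
  have eZ := eq_mul_of_rightTurn hYZ.symm hZ turnZ
  have hs : 0 < dist X Y := dist_pos.2 hXY
  have hc : 0 < dist Y Z := dist_pos.2 hYZ
  have he : 0 ≤ dist Z R := dist_nonneg
  rw [dist_comm R Z]
  have hd : (X - A).re ^ 2 + (X - A).im ^ 2 = 1 := by
    rw [dist_comm, dist_eq_norm] at h1
    have : ‖X - A‖ ^ 2 = 1 := by rw [h1]; norm_num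
    rw [Complex.sq_norm, Complex.normSq_apply] at this
    linarith
  have hAR : dist A R = ‖A - R‖ := dist_eq_norm _ _
  rw [hAR]
  rw [h1] at eX
  generalize dist X Y = s at *
  generalize dist Y Z = c at *
  generalize dist Z R = e at *
  have h3 : √3 ^ 2 = 3 := Real.sq_sqrt (by norm_num)
  have hζ : (⟨1 / 2, -(√3 / 2)⟩ : ℂ) ^ 2 = ⟨1 / 2, -(√3 / 2)⟩ - 1 := by
    apply Complex.ext
    · simp [pow_two]; nlinarith
    · simp [pow_two]; ring
  have hre : (⟨1 / 2, -(√3 / 2)⟩ : ℂ).re = 1 / 2 := rfl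
  have him : (⟨1 / 2, -(√3 / 2)⟩ : ℂ).im = -(√3 / 2) := rfl
  generalize (⟨1 / 2, -(√3 / 2)⟩ : ℂ) = ζ at *
  have hs' : (s : ℂ) ≠ 0 := by exact_mod_cast hs.ne'
  have hc' : (c : ℂ) ≠ 0 := by exact_mod_cast hc.ne'
  have eY' : Z - Y = c * (ζ - 1) * (X - A) := by
    rw [eY, eX, ← hζ]; push_cast; field_simp
  -- Here `ζ ^ 3 = -1`: three turns by 60 degrees reverse the direction.
  have eZR : Z - R = (e : ℂ) * (X - A) := by
    rw [← neg_sub R Z, eZ, eY']; push_cast; field_simp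
    linear_combination -(e : ℂ) * hζ
  have eAR : A - R = ((c + e - 1 : ℝ) - (s + c : ℝ) * ζ) * (X - A) := by
    have : A - R = -(X - A) - (Y - X) - (Z - Y) + (Z - R) := by ring
    rw [this, eX, eY', eZR]; push_cast; ring
  have hN := Complex.sq_norm (A - R)
  have hN0 := norm_nonneg (A - R)
  generalize ‖A - R‖ = N at *
  generalize X - A = d at *
  rw [eAR, eZR]
  rw [eAR, map_mul, Complex.normSq_apply, Complex.normSq_apply] at hN
  simp only [Complex.inner, Complex.mul_re, Complex.mul_im, Complex.sub_re, Complex.sub_im,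
    Complex.conj_re, Complex.conj_im, Complex.ofReal_re, Complex.ofReal_im, hre, him] at hN ⊢
  -- `h` is the component of `A - R` along the unit vector `X - A`; the orthogonal one has size `√3
  -- * (s + c) / 2`. So an angle of at least 60 degrees means `h ≤ (s + c) / 2`, that is, `e ≤ s +
  -- 1`.
  obtain ⟨h, hh⟩ : ∃ h, h = c + e - 1 - (s + c) / 2 := ⟨_, rfl⟩
  have hN' : N ^ 2 = h ^ 2 + 3 * ((s + c) / 2) ^ 2 := by
    rw [hN, hh]
    linear_combination ((c + e - 1 - (s + c) / 2) ^ 2 + 3 * ((s + c) / 2) ^ 2) * hd +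
      ((s + c) / 2) ^ 2 * (d.re ^ 2 + d.im ^ 2) * h3
  have hle : h ≤ N / 2 := by
    have : h ≤ (s + c) / 2 := by linarith
    by_contra! hcon
    nlinarith
  have hgoal := mul_le_mul_of_nonneg_left hle he
  rw [hh] at hgoal
  linear_combination hgoal + e * (c + e - 1 - (s + c) / 2) * hd

/-! ### Exchange arguments in a Steiner minimal tree -/

theorem edgeLength_mk (x y : ℂ) : edgeLength s(x, y) = dist x y := rfl

theorem edgeLength_nonneg (a : Sym2 ℂ) : 0 ≤ edgeLength a := by
  induction a with | h x y => exact dist_nonneg (x := x) (y := y)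

theorem netLength_union_le (S T : Finset (Sym2 ℂ)) :
    netLength (S ∪ T) ≤ netLength S + netLength T := by
  unfold netLength
  rw [← Finset.sum_union_inter]
  exact le_add_of_nonneg_right (Finset.sum_nonneg fun a _ => edgeLength_nonneg a)

theorem netLength_insert_le (a : Sym2 ℂ) (S : Finset (Sym2 ℂ)) :
    netLength (insert a S) ≤ edgeLength a + netLength S := by
  have := netLength_union_le {a} S
  rwa [← Finset.insert_eq, netLength.eq_1 {a}, Finset.sum_singleton] at this

theorem netGraph_adj {S : Finset (Sym2 ℂ)} {x y : ℂ} :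
    (netGraph S).Adj x y ↔ s(x, y) ∈ S ∧ x ≠ y := by
  simp [netGraph]

theorem reachable_of_mk_mem {S : Finset (Sym2 ℂ)} {x y : ℂ} (h : s(x, y) ∈ S) :
    (netGraph S).Reachable x y := by
  by_cases hxy : x = y
  · rw [hxy]
  · exact (netGraph_adj.2 ⟨h, hxy⟩).reachable

theorem SimpleGraph.Reachable.of_forall_adj {V : Type*} {G H : SimpleGraph V}
    (h : ∀ u v, G.Adj u v → H.Reachable u v) {u v : V} (huv : G.Reachable u v) :
    H.Reachable u v := by
  obtain ⟨p⟩ := huv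
  induction p with
  | nil => rfl
  | cons hadj _ ih => exact (h _ _ hadj).trans ih

namespace IsSteinerMinimalTree

variable {V : Finset ℂ} {S : Finset (Sym2 ℂ)}

/-- Edges whose endpoints stay connected after replacing them by other edges are not longer than
these. -/
theorem netLength_le_of_exchange (hS : IsSteinerMinimalTree V S) {D N : Finset (Sym2 ℂ)}
    (hD : D ⊆ S) (h : ∀ u v, s(u, v) ∈ D → (netGraph (S \ D ∪ N)).Reachable u v) :
    netLength D ≤ netLength N := by
  have h1 := hS.minimal (S \ D ∪ N) fun u hu v hv =>
    (hS.interconnects u hu v hv).of_forall_adj fun x y hxy => by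
      by_cases hxD : s(x, y) ∈ D
      · exact h x y hxD
      · exact reachable_of_mk_mem (Finset.mem_union_left _
          (Finset.mem_sdiff.2 ⟨(netGraph_adj.1 hxy).1, hxD⟩))
  have h2 := netLength_union_le (S \ D) N
  have h3 : netLength (S \ D) + netLength D = netLength S := Finset.sum_sdiff hD
  linarith

/-- If a walk leads from `A` to `P` without using the edge `PQ`, then `|PQ| ≤ |AQ|`. -/
theorem dist_le_dist_of_walk (hS : IsSteinerMinimalTree V S) {A P Q : ℂ}
    (hPQ : (netGraph S).Adj P Q) (p : (netGraph S).Walk A P) (hp : s(P, Q) ∉ p.edges) :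
    dist P Q ≤ dist A Q := by
  have hreach : (netGraph (S \ {s(P, Q)} ∪ {s(A, Q)})).Reachable P Q := by
    have h1 : (netGraph (S \ {s(P, Q)} ∪ {s(A, Q)})).Reachable A P := by
      refine ⟨p.transfer _ fun a ha => ?_⟩
      have haS := p.edges_subset_edgeSet ha
      induction a with | h x y =>
      have hxy := netGraph_adj.1 haS
      refine netGraph_adj.2 ⟨Finset.mem_union_left _ (Finset.mem_sdiff.2 ⟨hxy.1, ?_⟩), hxy.2⟩
      rw [Finset.mem_singleton]
      rintro heq
      exact hp (heq ▸ ha)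
    exact h1.symm.trans (reachable_of_mk_mem (Finset.mem_union_right _ (by simp)))
  have := hS.netLength_le_of_exchange (D := {s(P, Q)}) (N := {s(A, Q)})
    (by simpa using (netGraph_adj.1 hPQ).1) (fun u v huv => by
      rw [Finset.mem_singleton, Sym2.eq_iff] at huv
      rcases huv with ⟨rfl, rfl⟩ | ⟨rfl, rfl⟩
      · exact hreach
      · exact hreach.symm)
  simpa [netLength, edgeLength_mk] using this

/-- An edge on a cycle could be exchanged for a loop of length zero at one of its ends. -/
theorem isAcyclic (hS : IsSteinerMinimalTree V S) : (netGraph S).IsAcyclic := by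
  rw [SimpleGraph.isAcyclic_iff_forall_adj_isBridge]
  intro P Q hPQ
  rw [SimpleGraph.isBridge_iff_forall_walk_mem_edges]
  intro p
  by_contra hp
  have := hS.dist_le_dist_of_walk hPQ p.reverse (by simpa using hp)
  rw [dist_self] at this
  exact hPQ.ne (dist_le_zero.1 this)

/-- Two edges that meet in a vertex enclose an angle of at least 120 degrees. -/
theorem inner_le (hS : IsSteinerMinimalTree V S) {P Q R : ℂ} (hQ : (netGraph S).Adj P Q)
    (hR : (netGraph S).Adj P R) (hQR : Q ≠ R) :
    ⟪Q - P, R - P⟫ ≤ -(‖Q - P‖ * ‖R - P‖ / 2) := by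
  by_contra! hcon
  obtain ⟨m, hm⟩ := exists_shorter_branching (sub_ne_zero.2 hQ.ne') (sub_ne_zero.2 hR.ne') hcon
  set N : Finset (Sym2 ℂ) := {s(P, P + m), s(P + m, Q), s(P + m, R)} with hN
  have hmem : ∀ a ∈ N, a ∈ S \ {s(P, Q), s(P, R)} ∪ N := fun a ha => Finset.mem_union_right _ ha
  have h0 := reachable_of_mk_mem (hmem s(P, P + m) (by simp [hN]))
  have h1 := h0.trans (reachable_of_mk_mem (hmem s(P + m, Q) (by simp [hN])))
  have h2 := h0.trans (reachable_of_mk_mem (hmem s(P + m, R) (by simp [hN])))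
  have hle := hS.netLength_le_of_exchange (D := {s(P, Q), s(P, R)}) (N := N) (by
      simp [Finset.insert_subset_iff, (netGraph_adj.1 hQ).1, (netGraph_adj.1 hR).1])
    (fun u v huv => by
      simp only [Finset.mem_insert, Finset.mem_singleton, Sym2.eq_iff] at huv
      rcases huv with (⟨rfl, rfl⟩ | ⟨rfl, rfl⟩) | (⟨rfl, rfl⟩ | ⟨rfl, rfl⟩)
      exacts [h1, h1.symm, h2, h2.symm])
  have hD : netLength {s(P, Q), s(P, R)} = ‖Q - P‖ + ‖R - P‖ := by
    rw [netLength, Finset.sum_pair (by simp [hQR, hR.ne]), edgeLength_mk, edgeLength_mk,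
      dist_eq_norm', dist_eq_norm']
  have hN' : netLength N ≤ ‖m‖ + (‖Q - P - m‖ + ‖R - P - m‖) := by
    refine (netLength_insert_le _ _).trans (add_le_add ?_ ((netLength_insert_le _ _).trans
      (add_le_add ?_ ?_)))
    · rw [edgeLength_mk, dist_eq_norm', add_sub_cancel_left]
    · rw [edgeLength_mk, dist_eq_norm', sub_sub]
    · rw [netLength, Finset.sum_singleton, edgeLength_mk, dist_eq_norm', sub_sub]
  linarith

/-- The same for the unit vectors along the two edges. -/
theorem inner_unit_le (hS : IsSteinerMinimalTree V S) {P Q R : ℂ} (hQ : (netGraph S).Adj P Q)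
    (hR : (netGraph S).Adj P R) (hQR : Q ≠ R) :
    ⟪‖Q - P‖⁻¹ • (Q - P), ‖R - P‖⁻¹ • (R - P)⟫ ≤ -(1 / 2) := by
  have h := hS.inner_le hQ hR hQR
  have hq : 0 < ‖Q - P‖ := norm_pos_iff.2 (sub_ne_zero.2 hQ.ne')
  have hr : 0 < ‖R - P‖ := norm_pos_iff.2 (sub_ne_zero.2 hR.ne')
  rw [real_inner_smul_left, real_inner_smul_right]
  have : ‖Q - P‖⁻¹ * (‖R - P‖⁻¹ * ⟪Q - P, R - P⟫) = ⟪Q - P, R - P⟫ / (‖Q - P‖ * ‖R - P‖) := by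
    field_simp
  rw [this, div_le_iff₀ (by positivity)]
  linarith

theorem exists_adj_ne_ne (hS : IsSteinerMinimalTree V S) {P : ℂ} (hP : IsSteinerPoint V S P)
    (Q R : ℂ) : ∃ T, (netGraph S).Adj P T ∧ T ≠ Q ∧ T ≠ R := by
  have h3 := hS.three_le_degree P hP
  by_contra! hcon
  have hsub : (netGraph S).neighborSet P ⊆ {Q, R} := fun T hT => by
    by_cases hTQ : T = Q
    · exact Or.inl hTQ
    · exact Or.inr (hcon T hT hTQ)
  have := (Set.ncard_le_ncard hsub (Set.toFinite _)).trans (Set.ncard_insert_le Q {R})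
  rw [Set.ncard_singleton] at this
  omega

/-- Two edges that meet in a Steiner point enclose an angle of 120 degrees. -/
theorem inner_eq (hS : IsSteinerMinimalTree V S) {P Q R : ℂ} (hP : IsSteinerPoint V S P)
    (hQ : (netGraph S).Adj Q P) (hR : (netGraph S).Adj P R) (hQR : Q ≠ R) :
    ⟪Q - P, R - P⟫ = -(dist Q P * dist P R / 2) := by
  -- A third edge turns the lower bound of 120 degrees into an equality.
  obtain ⟨T, hT, hTQ, hTR⟩ := hS.exists_adj_ne_ne hP Q R
  have hq : ‖Q - P‖ ≠ 0 := norm_ne_zero_iff.2 (sub_ne_zero.2 hQ.ne)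
  have hr : ‖R - P‖ ≠ 0 := norm_ne_zero_iff.2 (sub_ne_zero.2 hR.ne')
  have h := (unit_triple_rigid (norm_smul_inv_norm (sub_ne_zero.2 hQ.ne))
    (norm_smul_inv_norm (sub_ne_zero.2 hR.ne')) (norm_smul_inv_norm (sub_ne_zero.2 hT.ne'))
    (hS.inner_unit_le hQ.symm hR hQR) (hS.inner_unit_le hQ.symm hT hTQ.symm)
    (hS.inner_unit_le hR hT hTR.symm)).2
  rw [real_inner_smul_left, real_inner_smul_right] at h
  simp only [RCLike.ofReal_real_eq_id, id] at h
  rw [dist_eq_norm, dist_eq_norm']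
  field_simp at h
  linarith

/-- If `PA` makes an angle of at least 60 degrees with an edge `PB` at the Steiner point `P`, then
it makes an angle of at most 60 degrees with another edge `PQ`. -/
theorem exists_adj_le_inner (hS : IsSteinerMinimalTree V S) {A B P : ℂ}
    (hP : IsSteinerPoint V S P) (hB : (netGraph S).Adj B P)
    (hang : ⟪A - P, B - P⟫ ≤ dist A P * dist P B / 2) :
    ∃ Q, (netGraph S).Adj P Q ∧ Q ≠ B ∧ dist A P * dist P Q / 2 ≤ ⟪A - P, Q - P⟫ := by
  obtain ⟨Q, hQ, hQB, -⟩ := hS.exists_adj_ne_ne hP B B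
  obtain ⟨T, hT, hTB, hTQ⟩ := hS.exists_adj_ne_ne hP B Q
  have hb : 0 < ‖B - P‖ := norm_pos_iff.2 (sub_ne_zero.2 hB.ne)
  have hq : 0 < ‖Q - P‖ := norm_pos_iff.2 (sub_ne_zero.2 hQ.ne')
  have ht : 0 < ‖T - P‖ := norm_pos_iff.2 (sub_ne_zero.2 hT.ne')
  simp only [dist_eq_norm' P, dist_eq_norm A] at hang ⊢
  have h := unit_triple_cover (norm_smul_inv_norm (sub_ne_zero.2 hB.ne))
    (norm_smul_inv_norm (sub_ne_zero.2 hQ.ne')) (norm_smul_inv_norm (sub_ne_zero.2 hT.ne'))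
    (hS.inner_unit_le hB.symm hQ hQB.symm) (hS.inner_unit_le hB.symm hT hTB.symm)
    (hS.inner_unit_le hQ hT hTQ.symm) (x := A - P) (by
      simp only [RCLike.ofReal_real_eq_id, id]
      rw [real_inner_smul_right, inv_mul_le_iff₀ hb]
      linarith)
  simp only [RCLike.ofReal_real_eq_id, id] at h
  rw [real_inner_smul_right, real_inner_smul_right, le_inv_mul_iff₀ hq, le_inv_mul_iff₀ ht] at h
  rcases h with h | h
  · exact ⟨Q, hQ, hQB, by linarith⟩
  · exact ⟨T, hT, hTB, by linarith⟩

/-! ### Extending a path to a regular point -/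

theorem length_le_card {A P : ℂ} {p : (netGraph S).Walk A P} (hp : p.IsPath) :
    p.length ≤ S.card := by
  classical
  rw [← p.length_edges, ← List.toFinset_card_of_nodup hp.isTrail.edges_nodup]
  refine Finset.card_le_card fun a ha => ?_
  have := p.edges_subset_edgeSet (List.mem_toFinset.1 ha)
  induction a with | h x y => exact (netGraph_adj.1 this).1

/-- A path of the tree from `A` to `P` whose last edge makes an angle of at least 60 degrees with
`PA` extends to a path that ends in a regular point not farther from `A` than `P`. -/
theorem exists_regular_extension (hS : IsSteinerMinimalTree V S) {A P : ℂ}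
    (p : (netGraph S).Walk A P) (hp : p.IsPath) (hnil : ¬ p.Nil)
    (hang : ⟪A - P, p.penultimate - P⟫ ≤ dist A P * dist P p.penultimate / 2) :
    ∃ E ∈ V, ∃ q : (netGraph S).Walk P E, (p.append q).IsPath ∧ dist A E ≤ dist A P := by
  -- By `length_le_card` this difference drops with each added edge.
  induction hn : S.card - p.length using Nat.strong_induction_on generalizing P with
  | _ n ih =>
  by_cases hPV : P ∈ V
  · exact ⟨P, hPV, .nil, by simpa using hp, le_rfl⟩
  have hB : (netGraph S).Adj p.penultimate P := p.adj_penultimate hnil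
  obtain ⟨Q, hPQ, hQB, hQ⟩ := hS.exists_adj_le_inner ⟨hPV, _, hB.symm⟩ hB hang
  have hQp : Q ∉ p.support := fun h => hQB (hS.isAcyclic.eq_penultimate_of_adj_end hp hPQ h)
  have hp' : (p.concat hPQ).IsPath := hp.concat hQp hPQ
  have hshort : dist P Q ≤ dist A Q :=
    hS.dist_le_dist_of_walk hPQ p fun h => hQp (p.snd_mem_support_of_mem_edges h)
  have hAP : 0 < dist A P := dist_pos.2 fun h => hnil (hp.nil_iff_eq.2 h)
  have hPQ0 : 0 < dist P Q := dist_pos.2 hPQ.ne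
  have cosP : dist A Q ^ 2 = dist A P ^ 2 + dist P Q ^ 2 - 2 * ⟪A - P, Q - P⟫ := by
    have := norm_sub_sq_real (A - P) (Q - P)
    rw [sub_sub_sub_cancel_right] at this
    rw [dist_eq_norm A, dist_eq_norm A, dist_eq_norm' P, this]
    ring
  have cosQ : dist A P ^ 2 = dist A Q ^ 2 + dist P Q ^ 2 - 2 * ⟪A - Q, P - Q⟫ := by
    have := norm_sub_sq_real (A - Q) (P - Q)
    rw [sub_sub_sub_cancel_right] at this
    rw [dist_eq_norm A, dist_eq_norm A, dist_eq_norm P, this]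
    ring
  -- The angle at `P` gives `|AQ|² ≤ |AP|² + |PQ|² - |AP| |PQ|`; combine with `|PQ| ≤ |AQ|`.
  have hle : dist P Q ≤ dist A P := by
    by_contra! hcon
    nlinarith
  have hAQ : dist A Q ≤ dist A P := by
    refine (sq_le_sq₀ dist_nonneg hAP.le).1 ?_
    nlinarith
  have hcard := length_le_card hp'
  rw [SimpleGraph.Walk.length_concat] at hcard
  obtain ⟨E, hE, q, hq, hAE⟩ := ih (S.card - (p.concat hPQ).length)
    (by rw [SimpleGraph.Walk.length_concat]; omega) (p.concat hPQ) hp'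
    (by rw [← SimpleGraph.Walk.length_eq_zero_iff, SimpleGraph.Walk.length_concat]; omega)
    (by
      rw [SimpleGraph.Walk.penultimate_concat, dist_comm Q P]
      nlinarith) rfl
  exact ⟨E, hE, .cons hPQ q, by rwa [SimpleGraph.Walk.concat_append] at hq, hAE.trans hAQ⟩

end IsSteinerMinimalTree

theorem mainTheorem12 (V : Finset ℂ) (S : Finset (Sym2 ℂ)) (hS : IsSteinerMinimalTree V S)
    (A X Y Z R : ℂ) (hA : A ∈ V)
    (hX : IsSteinerPoint V S X) (hY : IsSteinerPoint V S Y) (hZ : IsSteinerPoint V S Z)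
    (hAX : (netGraph S).Adj A X) (hXY : (netGraph S).Adj X Y)
    (hYZ : (netGraph S).Adj Y Z) (hZR : (netGraph S).Adj Z R)
    (turnX : RightTurn A X Y) (turnY : RightTurn X Y Z) (turnZ : RightTurn Y Z R)
    (s c e : ℝ) (h1 : dist A X = 1) (hs : dist X Y = s) (hc : dist Y Z = c) (he : dist Z R = e)
    (hes : e < s + 1) :
    ∃ E ∈ V,
      (∃ q : (netGraph S).Walk R E,
        (SimpleGraph.Walk.cons hAX (SimpleGraph.Walk.cons hXY
          (SimpleGraph.Walk.cons hYZ (SimpleGraph.Walk.cons hZR q)))).IsPath) ∧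
      dist A E ≤ max (max (dist A Y) (dist A Z)) (max (dist A R) (e + c - 1)) := by
  subst hs hc he
  have ne_of_turn : ∀ {P Q T : ℂ}, RightTurn P Q T → P ≠ T := by
    rintro P Q T h rfl
    unfold RightTurn at h
    simp only [Complex.sub_re, Complex.sub_im] at h
    linarith
  have hang := inner_le_of_three_rightTurns (hS.inner_eq hX hAX hXY (ne_of_turn turnX))
    (hS.inner_eq hY hXY hYZ (ne_of_turn turnY)) (hS.inner_eq hZ hYZ hZR (ne_of_turn turnZ))
    turnX turnY turnZ hXY.ne hYZ.ne h1 hes.le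
  have hac := hS.isAcyclic
  -- In an acyclic graph a path stays a path as long as it does not backtrack.
  have step : ∀ {P Q T : ℂ} (p : (netGraph S).Walk A P) (hQ : (netGraph S).Adj P Q)
      (hT : (netGraph S).Adj Q T), (p.concat hQ).IsPath → P ≠ T →
      ((p.concat hQ).concat hT).IsPath := by
    intro P Q T p hQ hT hp hPT
    refine hp.concat (fun h => hPT ?_) hT
    have := hac.eq_penultimate_of_adj_end hp hT h
    rw [SimpleGraph.Walk.penultimate_concat] at this
    exact this.symm
  have hpath := step _ hYZ hZR (step _ hXY hYZ (step .nil hAX hXY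
    (by simp [SimpleGraph.Walk.concat, hAX.ne]) (ne_of_turn turnX)) (ne_of_turn turnY))
    (ne_of_turn turnZ)
  obtain ⟨E, hE, q, hq, hAE⟩ := hS.exists_regular_extension _ hpath
    (by rw [← SimpleGraph.Walk.length_eq_zero_iff]; simp)
    (by rwa [SimpleGraph.Walk.penultimate_concat])
  rw [SimpleGraph.Walk.concat_append, SimpleGraph.Walk.concat_append,
    SimpleGraph.Walk.concat_append, SimpleGraph.Walk.concat_append,
    SimpleGraph.Walk.nil_append] at hq
  -- The entry `|AR|` of the maximum already suffices.
  exact ⟨E, hE, ⟨q, hq⟩,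
    hAE.trans (le_max_of_le_right (le_max_left _ _))⟩
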